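/- For $z$ in the upper half-plane let $q=e^{2\pi i z}$, $q^{1/2}=e^{\pi i z}$ and $\sigma_a(n)=\sum_{d\mid n}d^a$. Let $$E_2=1-24\sum_{n\ge1}\sigma_1(n)q^n,\qquad E_4=1+240\sum_{n\ge1}\sigma_3(n)q^n,\qquad E_6=1-504\sum_{n\ge1}\sigma_5(n)q^n,$$ $$\Delta=\frac{E_4^3-E_6^2}{1728}=q\prod_{n\ge1}(1-q^n)^{24},\qquad \Theta_2=\sum_{n\in\mathbb Z}q^{\frac12(n+\frac12)^2},\qquad \Theta_4=\sum_{n\in\mathbb Z}(-1)^nq^{\frac{n^2}{2}}.$$ Define $$\varphi=-\frac{49E_2^2E_4^3-25E_2^2E_6^2-48E_2E_4^2E_6-25E_4^4+49E_4E_6^2}{\Delta^2},\qquad \psi_S=-\frac{\Theta_2^{20}\left(2\Theta_2^8+7\Theta_2^4\Theta_4^4+7\Theta_4^8\right)}{\Delta^2}.$$ **Theorem.** For all real $t>0$, the numbers $\varphi(it)$ and $\psi_S(it)$ are real, and $$\varphi(it)+\frac{432}{\pi^2}\psi_S(it)<0,\qquad \varphi(it)-\frac{432}{\pi^2}\psi_S(it)>0.$$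 Moreover, for all real $t\ge1$, $$t^{10}\left(\varphi\!\left(\frac it\right)-\frac{432}{\pi^2}\psi_S\!\left(\frac it\right)\right)\ \ge\ \frac{725760}{\pi}\,e^{2\pi t}\left(t-\frac{10}{3\pi}\right).$$ -/

import Mathlib

open scoped ComplexOrder

noncomputable section

namespace Dim24

/-- The theta function `Θ₂(z) = ∑_{n ∈ ℤ} q ^ ((n + 1/2)² / 2)`, where `q ^ (1/2) = e ^ (π i z)`. -/
def theta2 (z : UpperHalfPlane) : ℂ :=
  ∑' n : ℤ, Complex.exp (Real.pi * Complex.I * ((n : ℂ) + 1 / 2) ^ 2 * (z : ℂ))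

/-- The theta function `Θ₄(z) = ∑_{n ∈ ℤ} (-1) ^ n q ^ (n² / 2)`, where `q ^ (1/2) = e ^ (π i z)`. -/
def theta4 (z : UpperHalfPlane) : ℂ :=
  ∑' n : ℤ, (-1 : ℂ) ^ n * Complex.exp (Real.pi * Complex.I * (n : ℂ) ^ 2 * (z : ℂ))

/-- The form `φ`, built from the normalised Eisenstein series `E₂`, `E₄`, `E₆` (constant term `1`)
and the discriminant `Δ = η ^ 24 = (E₄³ - E₆²) / 1728`, which has no zeros. -/
def varphi (z : UpperHalfPlane) : ℂ :=
  -(49 * EisensteinSeries.E2 z ^ 2 * ModularForm.E₄ z ^ 3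
      - 25 * EisensteinSeries.E2 z ^ 2 * ModularForm.E₆ z ^ 2
      - 48 * EisensteinSeries.E2 z * ModularForm.E₄ z ^ 2 * ModularForm.E₆ z
      - 25 * ModularForm.E₄ z ^ 4
      + 49 * ModularForm.E₄ z * ModularForm.E₆ z ^ 2)
    / ModularForm.discriminant z ^ 2

/-- The form `ψ_S`, built from `Θ₂`, `Θ₄` and `Δ`. -/
def psiS (z : UpperHalfPlane) : ℂ :=
  -(theta2 z ^ 20
      * (2 * theta2 z ^ 8 + 7 * theta2 z ^ 4 * theta4 z ^ 4 + 7 * theta4 z ^ 8))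
    / ModularForm.discriminant z ^ 2

/-- The point `i t` of the upper half-plane, for `t > 0`. -/
def imAxis (t : ℝ) (ht : 0 < t) : UpperHalfPlane :=
  ⟨Complex.I * (t : ℂ), by simpa using ht⟩

end Dim24

end

namespace Dim24

open UpperHalfPlane hiding I
open Complex Filter Topology
open scoped Real Manifold MatrixGroups ModularForm Derivative ArithmeticFunction.sigma

/-! Write P, Q, R for E₂, E₄, E₆ and S_{j,k} = ∑ n^j σ_k(n) q^n. The bracket in φ equals 24 (PR −
Q²)² + 49 (Q³ − R²)(P² − Q). Ramanujan's identities express P² − Q and PR − Q² through S_{1,1} and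
S_{1,5}, so the bracket is a positive multiple of S_{1,5}² − Δ S_{1,1}. On the imaginary axis
S_{1,5} ≥ S_{1,1} > q ≥ Δ, hence φ < 0. Also ψ_S < 0, since its polynomial has positive coefficients
and Θ₂⁴ > 0, Θ₄⁴ ≥ 0. This gives the first inequality for every t.

For the lower bound, invert: E₂(i/t) = −t² (P − 6/(πt)), so t^10 φ(i/t) is quadratic in t, with the
Taylor coefficients of the bracket in P as coefficients (`phiNum`, `phiNumLinear`,
`phiNumQuadratic`), while Θ₂⁴ and Θ₄⁴ trade places. Once the main term is removed, the part free of
t cancels through order q. For t ≥ 1 its q² remainder and the t² term are outweighed by the q² gain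
in the term linear in t (`numerator_sub_leading_nonneg`).

For the second inequality, if t ≥ 0.94 the numerator of φ, of order q³, is smaller than that of
(432/π²) ψ_S, of order q^(5/2). If t ≤ 0.94, the lower bound at 1/t applies and is positive because
1/t > 10/(3π). -/

/-! ### Level one forms and q-expansions -/

/-- A level one form of weight less than `12` that vanishes at `i∞` is zero. -/
theorem eq_zero_of_weight_lt_twelve {k : ℤ} (hk : k < 12) {f : ℍ → ℂ} (hf : MDiff f)
    (hinv : ∀ γ : SL(2, ℤ), f ∣[k] γ = f) (h0 : IsZeroAtImInfty f) : f = 0 := by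
  let g : CuspForm 𝒮ℒ k :=
    { toFun := f
      slash_action_eq' := by
        rintro A ⟨A, rfl⟩
        exact hinv A
      holo' := hf
      zero_at_cusps' := by
        intro c hc
        rw [Subgroup.IsArithmetic.isCusp_iff_isCusp_SL2Z] at hc
        rw [OnePoint.isZeroAt_iff_forall_SL2Z hc]
        intro γ _
        rw [hinv]
        exact h0 }
  have hg : g = 0 := rank_zero_iff_forall_zero.mp (CuspForm.rank_eq_zero_of_weight_lt_twelve hk) g
  exact congrArg DFunLike.coe hg

/-- A function given by a convergent `q`-expansion tends to its constant coefficient at `i∞`. -/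
theorem tendsto_of_hasSum_qExpansion {f : ℍ → ℂ} {c : ℕ → ℂ}
    (hf : ∀ τ : ℍ, HasSum (fun m ↦ c m * Function.Periodic.qParam 1 τ ^ m) (f τ)) :
    Tendsto f atImInfty (𝓝 (c 0)) := by
  have hq : ∀ τ : ℍ, Function.Periodic.qParam 1 τ ≠ 0 := fun τ ↦ Complex.exp_ne_zero _
  -- (f − c 0)/q again has a q-expansion, hence is bounded at i∞; multiplying back by q → 0 gives
  -- the limit.
  have hb : IsBoundedAtImInfty
      (fun τ : ℍ ↦ (f τ - c 0) * (Function.Periodic.qParam 1 τ)⁻¹) := by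
    refine isBoundedAtImInfty_of_hasSum_qExpansion (c := fun m ↦ c (m + 1)) one_pos fun τ ↦ ?_
    have h1 := ((hasSum_nat_add_iff' 1).mpr (hf τ)).mul_right (Function.Periodic.qParam 1 τ)⁻¹
    simp only [Finset.range_one, Finset.sum_singleton, pow_zero, mul_one] at h1
    refine h1.congr_fun fun m ↦ ?_
    rw [smul_eq_mul, pow_succ, ← mul_assoc, mul_inv_cancel_right₀ (hq τ)]
  have hz : Tendsto (fun τ : ℍ ↦ Function.Periodic.qParam 1 τ) atImInfty (𝓝 0) :=
    qParam_tendsto_atImInfty one_pos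
  have h2 : Tendsto (fun τ : ℍ ↦ Function.Periodic.qParam 1 τ *
      ((f τ - c 0) * (Function.Periodic.qParam 1 τ)⁻¹)) atImInfty (𝓝 0) :=
    hz.zero_mul_isBoundedUnder_le
      (by simpa [Function.comp_def] using (Asymptotics.isBigO_one_iff ℝ).mp hb)
  have h3 : (fun τ : ℍ ↦ Function.Periodic.qParam 1 τ *
      ((f τ - c 0) * (Function.Periodic.qParam 1 τ)⁻¹)) = fun τ ↦ f τ - c 0 := by
    ext τ
    have := hq τ
    field_simp
  rw [h3] at h2
  simpa using h2.add_const (c 0)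

/-- Termwise differentiation of a `q`-expansion. -/
theorem hasSum_normalizedDeriv {f : ℍ → ℂ} {c : ℕ → ℂ}
    (hf : ∀ τ : ℍ, HasSum (fun m ↦ c m * Function.Periodic.qParam 1 τ ^ m) (f τ)) (τ : ℍ) :
    HasSum (fun m : ℕ ↦ (m * c m) * Function.Periodic.qParam 1 τ ^ m) (D f τ) := by
  have hτ := τ.im_pos
  -- Weierstrass test on Im w > Im τ / 2: each term is dominated by its absolute value at ρ.
  let ρ : ℍ := ⟨τ.im / 2 * I, by simpa using hτ⟩
  let U : Set ℂ := {w | τ.im / 2 < w.im}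
  have hU : IsOpen U := isOpen_lt continuous_const Complex.continuous_im
  have hsum : Summable fun m ↦ ‖c m * Function.Periodic.qParam 1 ρ ^ m‖ := (hf ρ).summable.norm
  have hd (m : ℕ) (w : ℂ) : HasDerivAt (fun w : ℂ ↦ c m * Function.Periodic.qParam 1 w ^ m)
      ((2 * π * I) * (m * c m * Function.Periodic.qParam 1 w ^ m)) w := by
    have h1 : HasDerivAt (fun w : ℂ ↦ c m * cexp (m * (2 * π * I * w / (1 : ℝ))))
        (c m * (cexp (m * (2 * π * I * w / (1 : ℝ))) * (m * (2 * π * I * 1 / (1 : ℝ))))) w :=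
      (((((hasDerivAt_id w).const_mul (2 * π * I)).div_const _).const_mul (m : ℂ)).cexp).const_mul _
    have h2 : (fun w : ℂ ↦ c m * cexp (m * (2 * π * I * w / (1 : ℝ)))) =
        fun w : ℂ ↦ c m * Function.Periodic.qParam 1 w ^ m := by
      ext w
      rw [Complex.exp_nat_mul, Function.Periodic.qParam]
    rw [h2] at h1
    convert h1 using 1
    rw [Complex.exp_nat_mul, Function.Periodic.qParam]
    push_cast
    ring
  have key := hasSum_deriv_of_summable_norm (z := (τ : ℂ)) (U := U) hsum
    (F := fun m w ↦ c m * Function.Periodic.qParam 1 w ^ m)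
    (fun m w _ ↦ (hd m w).differentiableAt.differentiableWithinAt) hU
    (fun m w hw ↦ by
      rw [norm_mul, norm_mul, norm_pow, norm_pow]
      refine mul_le_mul_of_nonneg_left ?_ (norm_nonneg _)
      rw [Function.Periodic.norm_qParam, Function.Periodic.norm_qParam]
      have : (ρ : ℂ).im ≤ w.im := by
        have hw' : τ.im / 2 < w.im := hw
        have : (ρ : ℂ).im = τ.im / 2 := by simp [ρ, ← UpperHalfPlane.coe_im]
        linarith
      refine pow_le_pow_left₀ (Real.exp_pos _).le (Real.exp_le_exp.mpr ?_) m
      simp only [div_one]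
      nlinarith [Real.pi_pos]) (by
        change τ.im / 2 < τ.im
        linarith)
  simp only [(hd _ _).deriv] at key
  have heq : (fun w : ℂ ↦ ∑' m, c m * Function.Periodic.qParam 1 w ^ m) =ᶠ[𝓝 (τ : ℂ)]
      f ∘ ofComplex := by
    filter_upwards [isOpen_upperHalfPlaneSet.mem_nhds τ.im_pos] with w hw
    rw [Function.comp_apply, ofComplex_apply_of_im_pos hw]
    exact (hf ⟨w, hw⟩).tsum_eq
  rw [heq.deriv_eq] at key
  have h3 := key.mul_left (2 * π * I)⁻¹
  refine h3.congr_fun fun m ↦ ?_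
  rw [inv_mul_cancel_left₀ two_pi_I_ne_zero]

/-- `E₂` is the sum of its `q`-expansion. -/
theorem hasSum_E2 (τ : ℍ) : HasSum (fun m : ℕ ↦ (if m = 0 then 1 else -24 * σ 1 m : ℂ) *
    Function.Periodic.qParam 1 τ ^ m) (EisensteinSeries.E2 τ) := by
  simpa [Function.Periodic.qParam] using EisensteinSeries.hasSum_qExpansion_E2 τ

/-- `E₄` is the sum of its `q`-expansion. -/
theorem hasSum_E4 (τ : ℍ) : HasSum (fun m : ℕ ↦ (if m = 0 then 1 else 240 * σ 3 m : ℂ) *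
    Function.Periodic.qParam 1 τ ^ m) (ModularForm.E₄ τ) := by
  have h := ModularForm.hasSum_qExpansion ModularForm.E₄ one_pos one_mem_strictPeriods_SL τ
  refine h.congr_fun fun m ↦ ?_
  rw [EisensteinSeries.E_qExpansion_coeff _ ⟨2, rfl⟩]
  norm_num [show bernoulli 4 = -1 / 30 by decide +kernel]

/-- `E₆` is the sum of its `q`-expansion. -/
theorem hasSum_E6 (τ : ℍ) : HasSum (fun m : ℕ ↦ (if m = 0 then 1 else -504 * σ 5 m : ℂ) *
    Function.Periodic.qParam 1 τ ^ m) (ModularForm.E₆ τ) := by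
  have h := ModularForm.hasSum_qExpansion ModularForm.E₆ one_pos one_mem_strictPeriods_SL τ
  refine h.congr_fun fun m ↦ ?_
  rw [EisensteinSeries.E_qExpansion_coeff _ ⟨3, rfl⟩]
  norm_num [show bernoulli 6 = 1 / 42 by decide +kernel]

/-! ### Ramanujan's identities -/

/-- The normalised derivative of the cocycle `c / (c z + d)`. -/
theorem normalizedDeriv_div_denom (γ : SL(2, ℤ)) (z : ℍ) :
    D (fun w : ℍ ↦ (γ 1 0 : ℂ) / denom γ w) z =
      -(2 * π * I)⁻¹ * ((γ 1 0 : ℂ) / denom γ z) ^ 2 := by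
  have h := (hasDerivAt_denom_zpow (γ : GL (Fin 2) ℝ) (-1) z).const_mul (γ 1 0 : ℂ)
  have heq : (fun w : ℍ ↦ (γ 1 0 : ℂ) / denom γ w) ∘ ofComplex =ᶠ[𝓝 (z : ℂ)]
      fun w ↦ (γ 1 0 : ℂ) * denom γ w ^ (-1 : ℤ) := by
    filter_upwards [isOpen_upperHalfPlaneSet.mem_nhds z.im_pos] with w hw
    rw [Function.comp_apply, ofComplex_apply_of_im_pos hw, zpow_neg_one, div_eq_mul_inv]
  rw [Derivative.normalizedDerivOfComplex, heq.deriv_eq, h.deriv]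
  have hz := denom_ne_zero (γ : GL (Fin 2) ℝ) z
  have e : ((γ : GL (Fin 2) ℝ) 1 0 : ℂ) = (γ 1 0 : ℂ) := by simp
  rw [e, show (-1 - 1 : ℤ) = -2 by norm_num, zpow_neg, show (2 : ℤ) = (2 : ℕ) by rfl, zpow_natCast]
  push_cast
  field_simp

theorem mdifferentiable_div_denom (γ : SL(2, ℤ)) :
    MDiff (fun w : ℍ ↦ (γ 1 0 : ℂ) / denom γ w) := by
  intro z
  rw [mdifferentiableAt_iff]
  have h := (hasDerivAt_denom_zpow (γ : GL (Fin 2) ℝ) (-1) z).const_mul (γ 1 0 : ℂ)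
  have heq : (fun w : ℍ ↦ (γ 1 0 : ℂ) / denom γ w) ∘ ofComplex =ᶠ[𝓝 (z : ℂ)]
      fun w ↦ (γ 1 0 : ℂ) * denom γ w ^ (-1 : ℤ) := by
    filter_upwards [isOpen_upperHalfPlaneSet.mem_nhds z.im_pos] with w hw
    rw [Function.comp_apply, ofComplex_apply_of_im_pos hw, zpow_neg_one, div_eq_mul_inv]
  exact h.differentiableAt.congr_of_eventuallyEq heq

theorem E2_slash (γ : SL(2, ℤ)) : EisensteinSeries.E2 ∣[(2 : ℤ)] γ =
    EisensteinSeries.E2 - (6 * I / π) • fun w : ℍ ↦ (γ 1 0 : ℂ) / denom γ w := by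
  have hπ : (π : ℂ) ≠ 0 := by exact_mod_cast Real.pi_ne_zero
  rw [EisensteinSeries.E2_slash_action]
  ext z
  simp only [Pi.sub_apply, Pi.smul_apply, smul_eq_mul, EisensteinSeries.D2, riemannZeta_two]
  field_simp

/-- The weight four form `D E₂ - E₂² / 12` is modular. -/
theorem normalizedDeriv_E2_sub_slash (γ : SL(2, ℤ)) :
    (D EisensteinSeries.E2 - (1 / 12 : ℂ) • (EisensteinSeries.E2 * EisensteinSeries.E2))
      ∣[(4 : ℤ)] γ =
    D EisensteinSeries.E2 - (1 / 12 : ℂ) • (EisensteinSeries.E2 * EisensteinSeries.E2) := by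
  have hπ : (π : ℂ) ≠ 0 := by exact_mod_cast Real.pi_ne_zero
  have hE := E2_mdifferentiable
  have hu := mdifferentiable_div_denom γ
  have h1 := Derivative.normalizedDerivOfComplex_SL_slash (k := 2) hE (γ := γ)
  have h2 := ModularForm.mul_slash_SL2 2 2 γ EisensteinSeries.E2 EisensteinSeries.E2
  rw [E2_slash, Derivative.normalizedDerivOfComplex_sub _ _ hE (hu.const_smul _),
    Derivative.normalizedDerivOfComplex_smul _ _ hu] at h1
  rw [E2_slash] at h2
  rw [sub_eq_add_neg, SlashAction.add_slash, SlashAction.neg_slash, ModularForm.SL_smul_slash]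
  ext z
  have h1z := congrFun h1 z
  have h2z := congrFun h2 z
  simp only [Pi.sub_apply, Pi.smul_apply, Pi.mul_apply, smul_eq_mul, normalizedDeriv_div_denom]
    at h1z h2z
  norm_num at h1z h2z
  simp only [Pi.add_apply, Pi.neg_apply, Pi.smul_apply, Pi.mul_apply, smul_eq_mul]
  rw [h2z]
  -- The terms in u E₂ and u² produced by D E₂ are exactly those produced by E₂² / 12.
  set u : ℂ := (γ 1 0 : ℂ) / denom γ z
  linear_combination -h1z

/-- Ramanujan's identity `D E₂ = (E₂² - E₄) / 12`. -/
theorem normalizedDeriv_E2 (z : ℍ) : D EisensteinSeries.E2 z =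
    (EisensteinSeries.E2 z ^ 2 - ModularForm.E₄ z) / 12 := by
  let f : ℍ → ℂ := (D EisensteinSeries.E2 -
    (1 / 12 : ℂ) • (EisensteinSeries.E2 * EisensteinSeries.E2)) + (1 / 12 : ℂ) • ModularForm.E₄
  have hinv4 (γ : SL(2, ℤ)) : (ModularForm.E₄ : ℍ → ℂ) ∣[(4 : ℤ)] γ = ModularForm.E₄ :=
    SlashInvariantFormClass.slash_action_eq ModularForm.E₄ _ ⟨γ, rfl⟩
  have h4 : MDiff (ModularForm.E₄ : ℍ → ℂ) := ModularFormClass.holo _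
  have h2 := E2_mdifferentiable
  have hf : f = 0 := by
    refine eq_zero_of_weight_lt_twelve (k := 4) (by norm_num) ?_ (fun γ ↦ ?_) ?_
    · exact ((Derivative.normalizedDerivOfComplex_mdifferentiable h2).sub
        ((h2.mul h2).const_smul _)).add (h4.const_smul _)
    · simp only [f]
      rw [SlashAction.add_slash, ModularForm.SL_smul_slash, hinv4, normalizedDeriv_E2_sub_slash]
    -- The constant terms cancel: 0 − 1/12 + 1/12.
    · have l1 := tendsto_of_hasSum_qExpansion hasSum_E2
      have l2 := tendsto_of_hasSum_qExpansion hasSum_E4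
      have l4 := tendsto_of_hasSum_qExpansion (hasSum_normalizedDeriv hasSum_E2)
      simp only [if_true] at l1 l2 l4
      have := (l4.sub ((l1.mul l1).const_mul (1 / 12))).add (l2.const_mul (1 / 12))
      norm_num at this
      refine this.congr fun τ ↦ ?_
      simp only [f, Pi.add_apply, Pi.sub_apply, Pi.smul_apply, Pi.mul_apply, smul_eq_mul]
  have := congrFun hf z
  simp [f] at this
  linear_combination this

/-- Ramanujan's identity `D E₆ = (E₂ E₆ - E₄²) / 2`. -/
theorem normalizedDeriv_E6 (z : ℍ) : D ModularForm.E₆ z =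
    (EisensteinSeries.E2 z * ModularForm.E₆ z - ModularForm.E₄ z ^ 2) / 2 := by
  let f : ℍ → ℂ := Derivative.serreDerivative (6 : ℤ) ModularForm.E₆ +
    (1 / 2 : ℂ) • (ModularForm.E₄ * ModularForm.E₄ : ℍ → ℂ)
  have hinv4 (γ : SL(2, ℤ)) : (ModularForm.E₄ : ℍ → ℂ) ∣[(4 : ℤ)] γ = ModularForm.E₄ :=
    SlashInvariantFormClass.slash_action_eq ModularForm.E₄ _ ⟨γ, rfl⟩
  have hinv6 (γ : SL(2, ℤ)) : (ModularForm.E₆ : ℍ → ℂ) ∣[(6 : ℤ)] γ = ModularForm.E₆ :=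
    SlashInvariantFormClass.slash_action_eq ModularForm.E₆ _ ⟨γ, rfl⟩
  have h4 : MDiff (ModularForm.E₄ : ℍ → ℂ) := ModularFormClass.holo _
  have h6 : MDiff (ModularForm.E₆ : ℍ → ℂ) := ModularFormClass.holo _
  have hf : f = 0 := by
    refine eq_zero_of_weight_lt_twelve (k := 8) (by norm_num) ?_ (fun γ ↦ ?_) ?_
    · exact (Derivative.serreDerivative_mdifferentiable _ h6).add ((h4.mul h4).const_smul _)
    · have e1 := Derivative.serreDerivative_slash_invariant h6 (hinv6 γ)
      have e2 := ModularForm.mul_slash_SL2 4 4 γ (ModularForm.E₄ : ℍ → ℂ) ModularForm.E₄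
      rw [hinv4] at e2
      simp only [f]
      rw [SlashAction.add_slash, ModularForm.SL_smul_slash]
      congr 1
      exact congrArg _ e2
    · have l1 := tendsto_of_hasSum_qExpansion hasSum_E2
      have l2 := tendsto_of_hasSum_qExpansion hasSum_E4
      have l3 := tendsto_of_hasSum_qExpansion hasSum_E6
      have l4 := tendsto_of_hasSum_qExpansion (hasSum_normalizedDeriv hasSum_E6)
      simp only [if_true] at l1 l2 l3 l4
      have := (l4.sub ((l1.const_mul (6 * 12⁻¹)).mul l3)).add ((l2.mul l2).const_mul (1 / 2))
      norm_num at this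
      refine this.congr fun τ ↦ ?_
      simp only [f, Pi.add_apply, Pi.smul_apply, Pi.mul_apply, smul_eq_mul,
        Derivative.serreDerivative_apply]
      push_cast
      ring
  have := congrFun hf z
  simp [f] at this
  linear_combination this

/-! ### Divisor-sum series and their tails -/

/-- The power series `∑ n ^ j σ_k(n) q ^ n`. -/
noncomputable def sigmaSum (j k : ℕ) (q : ℝ) : ℝ := ∑' n : ℕ, ((n : ℝ) ^ j * σ k n) * q ^ n

theorem pow_mul_sigma_le (j k n : ℕ) : (n : ℝ) ^ j * σ k n ≤ (n : ℝ) ^ (j + (k + 1)) := by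
  rw [pow_add]
  gcongr
  exact_mod_cast ArithmeticFunction.sigma_le_pow_succ k n

theorem summable_sigmaSum (j k : ℕ) {q : ℝ} (h0 : 0 ≤ q) (h1 : q < 1) :
    Summable fun n : ℕ ↦ ((n : ℝ) ^ j * σ k n) * q ^ n := by
  refine Summable.of_nonneg_of_le (fun n ↦ by positivity) (fun n ↦ ?_)
    (summable_pow_mul_geometric_of_norm_lt_one (j + (k + 1)) (r := q)
      (by rwa [Real.norm_of_nonneg h0]))
  exact mul_le_mul_of_nonneg_right (pow_mul_sigma_le j k n) (by positivity)

theorem sum_range_le_sigmaSum (j k m : ℕ) {q : ℝ} (h0 : 0 ≤ q) (h1 : q < 1) :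
    ∑ n ∈ Finset.range m, ((n : ℝ) ^ j * σ k n) * q ^ n ≤ sigmaSum j k q :=
  (summable_sigmaSum j k h0 h1).sum_le_tsum _ fun n _ ↦ by positivity

/-- Consecutive seventh powers grow by at most (5/4)^7 < 5, so tails starting at n = 4 are dominated
by a geometric series. -/
theorem add_four_pow_seven_le (n : ℕ) : ((n + 4 : ℕ) : ℝ) ^ 7 ≤ 4 ^ 7 * 5 ^ n := by
  induction n with
  | zero => norm_num
  | succ n ih =>
    have h : (4 : ℝ) * ((n + 1 + 4 : ℕ) : ℝ) ≤ 5 * ((n + 4 : ℕ) : ℝ) := by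
      push_cast
      linarith [n.cast_nonneg (α := ℝ)]
    have h7 := pow_le_pow_left₀ (by positivity) h 7
    rw [mul_pow, mul_pow] at h7
    rw [pow_succ (5 : ℝ) n]
    nlinarith [pow_nonneg (Nat.cast_nonneg (α := ℝ) (n + 4)) 7]

/-- An upper bound for `∑ n ^ j σ_k(n) q ^ n` with a cubic error term, for small `q`. -/
theorem sigmaSum_le {j k : ℕ} (hjk : j + (k + 1) ≤ 7) {q : ℝ} (h0 : 0 < q) (h1 : q ≤ 28 / 10000) :
    sigmaSum j k q ≤
      ∑ n ∈ Finset.range 4, ((n : ℝ) ^ j * σ k n) * q ^ n + 47 * q ^ 3 := by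
  have hs := summable_sigmaSum j k h0.le (by linarith)
  rw [sigmaSum, ← hs.sum_add_tsum_nat_add 4]
  gcongr
  have hg : HasSum (fun n : ℕ ↦ (4 ^ 7 * q ^ 4) * (5 * q) ^ n) ((4 ^ 7 * q ^ 4) * (1 - 5 * q)⁻¹) :=
    (hasSum_geometric_of_lt_one (by positivity) (by linarith)).mul_left _
  calc ∑' n : ℕ, ((n + 4 : ℕ) : ℝ) ^ j * σ k (n + 4) * q ^ (n + 4)
      ≤ ∑' n : ℕ, (4 ^ 7 * q ^ 4) * (5 * q) ^ n := by
        refine ((summable_nat_add_iff 4).mpr hs).tsum_le_tsum (fun n ↦ ?_) hg.summable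
        calc ((n + 4 : ℕ) : ℝ) ^ j * σ k (n + 4) * q ^ (n + 4)
            ≤ (4 ^ 7 * 5 ^ n) * q ^ (n + 4) := by
              refine mul_le_mul_of_nonneg_right ?_ (by positivity)
              refine (pow_mul_sigma_le j k (n + 4)).trans
                (le_trans ?_ (add_four_pow_seven_le n))
              exact pow_le_pow_right₀ (by push_cast; linarith [n.cast_nonneg (α := ℝ)]) hjk
          _ = (4 ^ 7 * q ^ 4) * (5 * q) ^ n := by ring
    _ = (4 ^ 7 * q ^ 4) * (1 - 5 * q)⁻¹ := hg.tsum_eq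
    -- For q ≤ 0.0028, 4^7 q / (1 − 5q) < 47.
    _ ≤ 47 * q ^ 3 := by
        rw [← div_eq_mul_inv, div_le_iff₀ (by linarith)]
        have : 0 < q ^ 3 := by positivity
        nlinarith

/-! ### Values on the imaginary axis -/

/-- The nome `q = e ^ (-2 π t)` of the point `i t`. -/
noncomputable def nome (t : ℝ) : ℝ := Real.exp (-2 * π * t)

theorem nome_pos (t : ℝ) : 0 < nome t := Real.exp_pos _

theorem nome_lt_one {t : ℝ} (ht : 0 < t) : nome t < 1 := by
  rw [nome, Real.exp_lt_one_iff]
  nlinarith [Real.pi_pos]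

theorem coe_imAxis (t : ℝ) (ht : 0 < t) : (imAxis t ht : ℂ) = I * t := rfl

theorem qParam_imAxis (t : ℝ) (ht : 0 < t) :
    Function.Periodic.qParam 1 (imAxis t ht) = (nome t : ℂ) := by
  rw [Function.Periodic.qParam, coe_imAxis, nome, Complex.ofReal_exp]
  congr 1
  push_cast
  linear_combination (2 * π * t : ℂ) * I_sq

theorem eq_one_add_mul_sigmaSum {k : ℕ} {a : ℝ} {v : ℂ} {t : ℝ} (ht : 0 < t)
    (h : HasSum (fun m : ℕ ↦ (if m = 0 then 1 else (a : ℂ) * σ k m : ℂ) *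
      Function.Periodic.qParam 1 (imAxis t ht) ^ m) v) :
    v = ((1 + a * sigmaSum 0 k (nome t) : ℝ) : ℂ) := by
  have h1 : HasSum (fun m : ℕ ↦ (if m = 0 then (1 : ℝ) else 0) +
      a * (((m : ℝ) ^ 0 * σ k m) * nome t ^ m)) (1 + a * sigmaSum 0 k (nome t)) :=
    (hasSum_ite_eq 0 (1 : ℝ)).add
      ((summable_sigmaSum 0 k (nome_pos t).le (nome_lt_one ht)).hasSum.mul_left a)
  refine h.unique ((Complex.hasSum_ofReal.mpr h1).congr_fun fun m ↦ ?_)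
  rw [qParam_imAxis]
  rcases eq_or_ne m 0 with rfl | hm
  · simp
  · simp [hm, mul_assoc]

theorem eq_mul_sigmaSum {k : ℕ} {a : ℝ} {v : ℂ} {t : ℝ} (ht : 0 < t)
    (h : HasSum (fun m : ℕ ↦ (m * (if m = 0 then 1 else (a : ℂ) * σ k m : ℂ)) *
      Function.Periodic.qParam 1 (imAxis t ht) ^ m) v) :
    v = ((a * sigmaSum 1 k (nome t) : ℝ) : ℂ) := by
  have h1 : HasSum (fun m : ℕ ↦ a * (((m : ℝ) ^ 1 * σ k m) * nome t ^ m))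
      (a * sigmaSum 1 k (nome t)) :=
    (summable_sigmaSum 1 k (nome_pos t).le (nome_lt_one ht)).hasSum.mul_left a
  refine h.unique ((Complex.hasSum_ofReal.mpr h1).congr_fun fun m ↦ ?_)
  rw [qParam_imAxis]
  rcases eq_or_ne m 0 with rfl | hm
  · simp
  · simp only [hm, if_false]
    push_cast
    ring

theorem E2_imAxis (t : ℝ) (ht : 0 < t) :
    EisensteinSeries.E2 (imAxis t ht) = ((1 - 24 * sigmaSum 0 1 (nome t) : ℝ) : ℂ) := by
  rw [eq_one_add_mul_sigmaSum (k := 1) (a := -24)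
    (v := EisensteinSeries.E2 (imAxis t ht)) ht (by simpa using hasSum_E2 (imAxis t ht))]
  push_cast
  ring

theorem E4_imAxis (t : ℝ) (ht : 0 < t) :
    ModularForm.E₄ (imAxis t ht) = ((1 + 240 * sigmaSum 0 3 (nome t) : ℝ) : ℂ) :=
  eq_one_add_mul_sigmaSum (a := 240) ht (by simpa using hasSum_E4 (imAxis t ht))

theorem E6_imAxis (t : ℝ) (ht : 0 < t) :
    ModularForm.E₆ (imAxis t ht) = ((1 - 504 * sigmaSum 0 5 (nome t) : ℝ) : ℂ) := by
  rw [eq_one_add_mul_sigmaSum (k := 5) (a := -504)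
    (v := ModularForm.E₆ (imAxis t ht)) ht (by simpa using hasSum_E6 (imAxis t ht))]
  push_cast
  ring

/-- The value of the discriminant in terms of divisor sums. -/
noncomputable def deltaSum (q : ℝ) : ℝ :=
  ((1 + 240 * sigmaSum 0 3 q) ^ 3 - (1 - 504 * sigmaSum 0 5 q) ^ 2) / 1728

theorem discriminant_imAxis (t : ℝ) (ht : 0 < t) :
    ModularForm.discriminant (imAxis t ht) = ((deltaSum (nome t) : ℝ) : ℂ) := by
  rw [ModularForm.discriminant_eq_E₄_cube_sub_E₆_sq, E4_imAxis, E6_imAxis, deltaSum]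
  push_cast
  ring

theorem deltaSum_ne_zero {t : ℝ} (ht : 0 < t) : deltaSum (nome t) ≠ 0 := by
  have h := ModularForm.discriminant_ne_zero (imAxis t ht)
  rw [discriminant_imAxis] at h
  exact_mod_cast h

/-- In q ∏ (1 − q^n)^24 every factor of the product lies in [0, 1]. -/
theorem deltaSum_le_nome {t : ℝ} (ht : 0 < t) : deltaSum (nome t) ≤ nome t := by
  have h := ModularForm.discriminant_eq_q_prod (imAxis t ht)
  rw [discriminant_imAxis, qParam_imAxis] at h
  have hm := ModularForm.multipliableLocallyUniformlyOn_eta.multipliable (imAxis t ht).2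
  rw [hm.tprod_pow 24] at h
  have hle : ‖∏' n, (1 - ModularForm.eta_q n (imAxis t ht))‖ ≤ 1 := by
    have hlim : Tendsto (fun s : Finset ℕ ↦ ∏ n ∈ s, (1 - ModularForm.eta_q n (imAxis t ht))) atTop
        (𝓝 (∏' n, (1 - ModularForm.eta_q n (imAxis t ht)))) := by
      simpa [HasProd] using hm.hasProd
    refine le_of_tendsto' hlim.norm fun s ↦ ?_
    rw [norm_prod]
    refine Finset.prod_le_one (fun _ _ ↦ norm_nonneg _) fun n _ ↦ ?_
    rw [ModularForm.eta_q, qParam_imAxis, ← Complex.ofReal_pow, ← Complex.ofReal_one,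
      ← Complex.ofReal_sub, Complex.norm_real, Real.norm_eq_abs, abs_le]
    have h1 : nome t ^ (n + 1) ≤ 1 := pow_le_one₀ (nome_pos t).le (nome_lt_one ht).le
    have h2 : 0 < nome t ^ (n + 1) := pow_pos (nome_pos t) _
    constructor <;> linarith
  have h' := congrArg norm h
  rw [norm_mul, norm_pow, Complex.norm_real, Complex.norm_real, Real.norm_eq_abs,
    Real.norm_of_nonneg (nome_pos t).le] at h'
  calc deltaSum (nome t) ≤ |deltaSum (nome t)| := le_abs_self _
    _ ≤ nome t := by
      rw [h']
      exact mul_le_of_le_one_right (nome_pos t).le (pow_le_one₀ (norm_nonneg _) hle)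

/-- Ramanujan's identity for `E₂` in terms of divisor sums. -/
theorem E2_sq_sub_E4 {t : ℝ} (ht : 0 < t) : (1 - 24 * sigmaSum 0 1 (nome t)) ^ 2 -
    (1 + 240 * sigmaSum 0 3 (nome t)) = -288 * sigmaSum 1 1 (nome t) := by
  have h1 := eq_mul_sigmaSum (k := 1) (a := -24) ht
    (by simpa using hasSum_normalizedDeriv hasSum_E2 (imAxis t ht))
  rw [normalizedDeriv_E2, E2_imAxis, E4_imAxis] at h1
  have h2 : ((1 - 24 * sigmaSum 0 1 (nome t)) ^ 2 - (1 + 240 * sigmaSum 0 3 (nome t))) / 12 =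
      -24 * sigmaSum 1 1 (nome t) := by exact_mod_cast h1
  linarith

/-- Ramanujan's identity for `E₆` in terms of divisor sums. -/
theorem E2_mul_E6_sub_E4_sq {t : ℝ} (ht : 0 < t) :
    (1 - 24 * sigmaSum 0 1 (nome t)) * (1 - 504 * sigmaSum 0 5 (nome t)) -
      (1 + 240 * sigmaSum 0 3 (nome t)) ^ 2 = -1008 * sigmaSum 1 5 (nome t) := by
  have h1 := eq_mul_sigmaSum (k := 5) (a := -504) ht
    (by simpa using hasSum_normalizedDeriv hasSum_E6 (imAxis t ht))
  rw [normalizedDeriv_E6, E2_imAxis, E4_imAxis, E6_imAxis] at h1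
  have h2 : ((1 - 24 * sigmaSum 0 1 (nome t)) * (1 - 504 * sigmaSum 0 5 (nome t)) -
      (1 + 240 * sigmaSum 0 3 (nome t)) ^ 2) / 2 =
      -504 * sigmaSum 1 5 (nome t) := by exact_mod_cast h1
  linarith

/-- The numerator of `-φ`, as a polynomial in divisor sums. -/
noncomputable def phiNum (q : ℝ) : ℝ :=
  24385536 * (sigmaSum 1 5 q ^ 2 - deltaSum q * sigmaSum 1 1 q)

/-- Half the derivative of the numerator of `-φ` with respect to `E₂`. -/
noncomputable def phiNumLinear (q : ℝ) : ℝ :=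
  84672 * deltaSum q * (1 - 24 * sigmaSum 0 1 q) -
    24192 * (1 - 504 * sigmaSum 0 5 q) * sigmaSum 1 5 q

/-- The coefficient of `E₂ ^ 2` in the numerator of `-φ`. -/
noncomputable def phiNumQuadratic (q : ℝ) : ℝ :=
  84672 * deltaSum q + 24 * (1 - 504 * sigmaSum 0 5 q) ^ 2

/-- The two halves of the bracket get the same constant: 24 · 1008² = 49 · 1728 · 288 = 24385536. -/
theorem varphi_imAxis (t : ℝ) (ht : 0 < t) : varphi (imAxis t ht) =
    ((-phiNum (nome t) / deltaSum (nome t) ^ 2 : ℝ) : ℂ) := by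
  have h1 := E2_sq_sub_E4 ht
  have h2 := E2_mul_E6_sub_E4_sq ht
  rw [varphi, E2_imAxis, E4_imAxis, E6_imAxis, discriminant_imAxis, phiNum]
  norm_cast
  congr 2
  have h3 : deltaSum (nome t) = ((1 + 240 * sigmaSum 0 3 (nome t)) ^ 3 -
    (1 - 504 * sigmaSum 0 5 (nome t)) ^ 2) / 1728 := rfl
  generalize deltaSum (nome t) = d at *
  generalize 1 - 24 * sigmaSum 0 1 (nome t) = P at *
  generalize 1 + 240 * sigmaSum 0 3 (nome t) = Q at *
  generalize 1 - 504 * sigmaSum 0 5 (nome t) = R at *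
  have h4 : sigmaSum 1 1 (nome t) = -(P ^ 2 - Q) / 288 := by linarith
  have h5 : sigmaSum 1 5 (nome t) = -(P * R - Q ^ 2) / 1008 := by linarith
  rw [h4, h5, h3]
  ring

/-! ### Inversion t ↦ 1/t for the Eisenstein series -/

theorem imAxis_inv_eq {t : ℝ} (ht : 0 < t) : imAxis (1 / t) (one_div_pos.mpr ht) =
    .mk _ (imAxis t ht).im_inv_neg_coe_pos := by
  ext
  have : (t : ℂ) ≠ 0 := by exact_mod_cast ht.ne'
  change I * ((1 / t : ℝ) : ℂ) = (-(I * (t : ℂ)))⁻¹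
  push_cast
  field_simp
  rw [I_sq]

theorem slash_S_imAxis (f : ℍ → ℂ) (k : ℤ) {t : ℝ} (ht : 0 < t) :
    f (imAxis (1 / t) (one_div_pos.mpr ht)) =
      (f ∣[k] ModularGroup.S) (imAxis t ht) * (I * t : ℂ) ^ k := by
  have h : (I * t : ℂ) ≠ 0 := mul_ne_zero I_ne_zero (by exact_mod_cast ht.ne')
  rw [SlashInvariantForm.slash_S_apply, ← imAxis_inv_eq, coe_imAxis, mul_assoc, ← zpow_add₀ h]
  simp

theorem E2_imAxis_inv {t : ℝ} (ht : 0 < t) :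
    EisensteinSeries.E2 (imAxis (1 / t) (one_div_pos.mpr ht)) =
      ((-t ^ 2 * (1 - 24 * sigmaSum 0 1 (nome t)) + 6 * t / π : ℝ) : ℂ) := by
  have hπ : (π : ℂ) ≠ 0 := by exact_mod_cast Real.pi_ne_zero
  have h : (t : ℂ) ≠ 0 := by exact_mod_cast ht.ne'
  rw [slash_S_imAxis EisensteinSeries.E2 2 ht, E2_slash, Pi.sub_apply, E2_imAxis]
  simp only [Pi.smul_apply, smul_eq_mul]
  have hd : denom (ModularGroup.S : GL (Fin 2) ℝ) (imAxis t ht) = I * t := by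
    rw [← coe_imAxis t ht]
    exact ModularGroup.denom_S _
  rw [hd, show (2 : ℤ) = (2 : ℕ) by rfl, zpow_natCast, mul_pow, I_sq]
  have hS : ((ModularGroup.S 1 0 : ℤ) : ℂ) = 1 := by simp [ModularGroup.S]
  rw [hS]
  push_cast
  field_simp
  ring

theorem E4_imAxis_inv {t : ℝ} (ht : 0 < t) :
    ModularForm.E₄ (imAxis (1 / t) (one_div_pos.mpr ht)) =
      ((t ^ 4 * (1 + 240 * sigmaSum 0 3 (nome t)) : ℝ) : ℂ) := by
  have h : (ModularForm.E₄ : ℍ → ℂ) ∣[(4 : ℤ)] ModularGroup.S = ModularForm.E₄ :=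
    SlashInvariantFormClass.slash_action_eq ModularForm.E₄ _ ⟨_, rfl⟩
  rw [slash_S_imAxis (ModularForm.E₄ : ℍ → ℂ) 4 ht, h, E4_imAxis, show (4 : ℤ) = (4 : ℕ) by rfl, zpow_natCast, mul_pow,
    I_pow_four]
  push_cast
  ring

theorem E6_imAxis_inv {t : ℝ} (ht : 0 < t) :
    ModularForm.E₆ (imAxis (1 / t) (one_div_pos.mpr ht)) =
      ((-t ^ 6 * (1 - 504 * sigmaSum 0 5 (nome t)) : ℝ) : ℂ) := by
  have h : (ModularForm.E₆ : ℍ → ℂ) ∣[(6 : ℤ)] ModularGroup.S = ModularForm.E₆ :=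
    SlashInvariantFormClass.slash_action_eq ModularForm.E₆ _ ⟨_, rfl⟩
  rw [slash_S_imAxis (ModularForm.E₆ : ℍ → ℂ) 6 ht, h, E6_imAxis, show (6 : ℤ) = (6 : ℕ) by rfl, zpow_natCast, mul_pow,
    show (6 : ℕ) = 4 + 2 by rfl, pow_add I, I_pow_four, I_sq]
  push_cast
  ring

theorem discriminant_imAxis_inv {t : ℝ} (ht : 0 < t) :
    ModularForm.discriminant (imAxis (1 / t) (one_div_pos.mpr ht)) =
      ((t ^ 12 * deltaSum (nome t) : ℝ) : ℂ) := by
  rw [ModularForm.discriminant_eq_E₄_cube_sub_E₆_sq, E4_imAxis_inv ht, E6_imAxis_inv ht, deltaSum]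
  push_cast
  ring

/-- The transformation of `φ` under `z ↦ -1 / z` on the imaginary axis. -/
theorem pow_mul_varphi_imAxis_inv {t : ℝ} (ht : 0 < t) :
    (t : ℂ) ^ 10 * varphi (imAxis (1 / t) (one_div_pos.mpr ht)) =
      (((-t ^ 2 * phiNum (nome t) + 12 / π * t * phiNumLinear (nome t) -
        36 / π ^ 2 * phiNumQuadratic (nome t)) / deltaSum (nome t) ^ 2 : ℝ) : ℂ) := by
  have h1 := E2_sq_sub_E4 ht
  have h2 := E2_mul_E6_sub_E4_sq ht
  have hd := deltaSum_ne_zero ht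
  rw [varphi, E2_imAxis_inv ht, E4_imAxis_inv ht, E6_imAxis_inv ht, discriminant_imAxis_inv ht, phiNum,
    phiNumLinear, phiNumQuadratic]
  norm_cast
  have h3 : deltaSum (nome t) = ((1 + 240 * sigmaSum 0 3 (nome t)) ^ 3 -
    (1 - 504 * sigmaSum 0 5 (nome t)) ^ 2) / 1728 := rfl
  generalize deltaSum (nome t) = d at *
  generalize 1 - 24 * sigmaSum 0 1 (nome t) = P at *
  generalize 1 + 240 * sigmaSum 0 3 (nome t) = Q at *
  generalize 1 - 504 * sigmaSum 0 5 (nome t) = R at *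
  have h4 : sigmaSum 1 1 (nome t) = -(P ^ 2 - Q) / 288 := by linarith
  have h5 : sigmaSum 1 5 (nome t) = -(P * R - Q ^ 2) / 1008 := by linarith
  rw [h4, h5]
  have hπ := Real.pi_ne_zero
  rw [mul_div_assoc', div_eq_div_iff (by positivity) (by positivity)]
  rw [h3]
  field_simp
  ring

/-! ### Theta functions: inversion and truncation -/

theorem theta4_eq_jacobiTheta₂ (z : ℍ) : theta4 z = jacobiTheta₂ (1 / 2) z := by
  rw [theta4, jacobiTheta₂]
  refine tsum_congr fun n ↦ ?_
  rw [jacobiTheta₂_term, Complex.exp_add]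
  congr 1
  rw [show 2 * (π : ℂ) * I * n * (1 / 2) = n * (π * I) by ring, Complex.exp_int_mul,
    Complex.exp_pi_mul_I]

theorem theta2_eq_jacobiTheta₂ (z : ℍ) :
    theta2 z = cexp (π * I * z / 4) * jacobiTheta₂ (z / 2) z := by
  rw [theta2, jacobiTheta₂, ← tsum_mul_left]
  refine tsum_congr fun n ↦ ?_
  rw [jacobiTheta₂_term, ← Complex.exp_add]
  congr 1
  ring

/-- The Gaussian factor in Jacobi's functional equation at 1/2 becomes the prefactor exp(πiz/4)
relating Θ₂ to `jacobiTheta₂`. -/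
theorem theta2_imAxis_inv {t : ℝ} (ht : 0 < t) :
    theta2 (imAxis (1 / t) (one_div_pos.mpr ht)) = (√t : ℝ) * theta4 (imAxis t ht) := by
  have h : (t : ℂ) ≠ 0 := by exact_mod_cast ht.ne'
  rw [theta4_eq_jacobiTheta₂, theta2_eq_jacobiTheta₂,
    jacobiTheta₂_functional_equation (1 / 2) (imAxis t ht), coe_imAxis, coe_imAxis]
  have e1 : -I * (I * t) = (t : ℂ) := by linear_combination (-t : ℂ) * I_sq
  have e2 : -1 / (I * t) = I * ((1 / t : ℝ) : ℂ) := by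
    push_cast
    field_simp
    rw [I_sq]
  have e3 : 1 / 2 / (I * t) = -(I * ((1 / t : ℝ) : ℂ) / 2) := by
    push_cast
    field_simp
    rw [I_sq, neg_neg]
  have e4 : (t : ℂ) ^ (1 / 2 : ℂ) = (√t : ℝ) := by
    rw [Real.sqrt_eq_rpow, Complex.ofReal_cpow ht.le]
    norm_num
  have e5 : ((√t : ℝ) : ℂ) ≠ 0 := by
    exact_mod_cast (Real.sqrt_pos.mpr ht).ne'
  have e6 : -(π : ℂ) * I * (1 / 2) ^ 2 / (I * t) = π * I * (I * ((1 / t : ℝ) : ℂ)) / 4 := by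
    push_cast
    field_simp
    rw [I_sq]
    ring
  rw [e1, e2, e3, e4, e6, jacobiTheta₂_neg_left]
  field_simp

/-- `Θ₂` on the imaginary axis. -/
noncomputable def realTheta2 (t : ℝ) : ℝ := ∑' n : ℤ, Real.exp (-π * ((n : ℝ) + 1 / 2) ^ 2 * t)

/-- `Θ₄` on the imaginary axis. -/
noncomputable def realTheta4 (t : ℝ) : ℝ := ∑' n : ℤ, (-1) ^ n * Real.exp (-π * (n : ℝ) ^ 2 * t)

theorem theta2_imAxis (t : ℝ) (ht : 0 < t) : theta2 (imAxis t ht) = (realTheta2 t : ℂ) := by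
  rw [theta2, realTheta2, Complex.ofReal_tsum]
  refine tsum_congr fun n ↦ ?_
  rw [coe_imAxis, Complex.ofReal_exp]
  congr 1
  push_cast
  linear_combination (π * ((n : ℂ) + 1 / 2) ^ 2 * t) * I_sq

theorem theta4_imAxis (t : ℝ) (ht : 0 < t) : theta4 (imAxis t ht) = (realTheta4 t : ℂ) := by
  rw [theta4, realTheta4, Complex.ofReal_tsum]
  refine tsum_congr fun n ↦ ?_
  rw [coe_imAxis, Complex.ofReal_mul, Complex.ofReal_exp]
  push_cast
  congr 2
  linear_combination (π * (n : ℂ) ^ 2 * t) * I_sq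

theorem realTheta2_inv_pow {t : ℝ} (ht : 0 < t) :
    realTheta2 (1 / t) ^ 4 = t ^ 2 * realTheta4 t ^ 4 := by
  have h := theta2_imAxis_inv ht
  rw [theta2_imAxis, theta4_imAxis] at h
  have h' : realTheta2 (1 / t) = √t * realTheta4 t := by exact_mod_cast h
  rw [h', mul_pow, show √t ^ 4 = (√t ^ 2) ^ 2 by ring, Real.sq_sqrt ht.le]

theorem realTheta4_inv_pow {t : ℝ} (ht : 0 < t) :
    realTheta4 (1 / t) ^ 4 = t ^ 2 * realTheta2 t ^ 4 := by
  have h := realTheta2_inv_pow (one_div_pos.mpr ht)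
  rw [one_div_one_div] at h
  rw [h]
  field_simp

/-- The polynomial in the theta functions in the numerator of `-ψ_S`. -/
def thetaPoly (a b : ℝ) : ℝ := a ^ 5 * (2 * a ^ 2 + 7 * a * b + 7 * b ^ 2)

theorem psiS_imAxis (t : ℝ) (ht : 0 < t) : psiS (imAxis t ht) =
    ((-thetaPoly (realTheta2 t ^ 4) (realTheta4 t ^ 4) / deltaSum (nome t) ^ 2 : ℝ) : ℂ) := by
  rw [psiS, theta2_imAxis, theta4_imAxis, discriminant_imAxis, thetaPoly]
  push_cast
  ring

theorem pow_mul_psiS_imAxis_inv {t : ℝ} (ht : 0 < t) :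
    (t : ℂ) ^ 10 * psiS (imAxis (1 / t) (one_div_pos.mpr ht)) =
    ((-thetaPoly (realTheta4 t ^ 4) (realTheta2 t ^ 4) / deltaSum (nome t) ^ 2 : ℝ) : ℂ) := by
  have h : t ^ 10 * (-(realTheta2 (1 / t) ^ 20 * (2 * realTheta2 (1 / t) ^ 8 +
      7 * realTheta2 (1 / t) ^ 4 * realTheta4 (1 / t) ^ 4 + 7 * realTheta4 (1 / t) ^ 8)) /
      (t ^ 12 * deltaSum (nome t)) ^ 2) =
      -thetaPoly (realTheta4 t ^ 4) (realTheta2 t ^ 4) / deltaSum (nome t) ^ 2 := by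
    rw [show realTheta2 (1 / t) ^ 20 = (realTheta2 (1 / t) ^ 4) ^ 5 by ring,
      show realTheta2 (1 / t) ^ 8 = (realTheta2 (1 / t) ^ 4) ^ 2 by ring,
      show realTheta4 (1 / t) ^ 8 = (realTheta4 (1 / t) ^ 4) ^ 2 by ring,
      realTheta2_inv_pow ht, realTheta4_inv_pow ht, thetaPoly]
    have hd := deltaSum_ne_zero ht
    field_simp
  rw [psiS, theta2_imAxis, theta4_imAxis, discriminant_imAxis_inv ht, ← h]
  push_cast
  ring

theorem summable_realTheta2 {t : ℝ} (ht : 0 < t) :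
    Summable fun n : ℤ ↦ Real.exp (-π * ((n : ℝ) + 1 / 2) ^ 2 * t) := by
  have h := ((hasSum_jacobiTheta₂_term ((imAxis t ht : ℂ) / 2)
    (imAxis t ht).im_pos).mul_left (cexp (π * I * (imAxis t ht : ℂ) / 4))).summable
  refine Complex.summable_ofReal.mp (h.congr fun n ↦ ?_)
  rw [jacobiTheta₂_term, ← Complex.exp_add, coe_imAxis, Complex.ofReal_exp]
  congr 1
  push_cast
  linear_combination (π * ((n : ℂ) + 1 / 2) ^ 2 * t) * I_sq

theorem summable_realTheta4 {t : ℝ} (ht : 0 < t) :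
    Summable fun n : ℤ ↦ (-1 : ℝ) ^ n * Real.exp (-π * (n : ℝ) ^ 2 * t) := by
  have h := (hasSum_jacobiTheta₂_term (1 / 2) (imAxis t ht).im_pos).summable
  refine Complex.summable_ofReal.mp (h.congr fun n ↦ ?_)
  rw [jacobiTheta₂_term, Complex.exp_add, coe_imAxis, Complex.ofReal_mul, Complex.ofReal_exp,
    show 2 * (π : ℂ) * I * n * (1 / 2) = n * (π * I) by ring, Complex.exp_int_mul,
    Complex.exp_pi_mul_I]
  push_cast
  congr 2
  linear_combination (π * (n : ℂ) ^ 2 * t) * I_sq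

theorem realTheta2_pos {t : ℝ} (ht : 0 < t) : 0 < realTheta2 t :=
  (summable_realTheta2 ht).tsum_pos (fun _ ↦ (Real.exp_pos _).le) 0 (Real.exp_pos _)

/-- The square root `e ^ (-π t)` of the nome. -/
noncomputable def halfNome (t : ℝ) : ℝ := Real.exp (-π * t)

theorem halfNome_pos (t : ℝ) : 0 < halfNome t := Real.exp_pos _

theorem nome_eq_sq (t : ℝ) : nome t = halfNome t ^ 2 := by
  rw [nome, halfNome, ← Real.exp_nat_mul]
  congr 1
  push_cast
  ring

theorem le_realTheta2_pow {t : ℝ} (ht : 0 < t) :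
    16 * halfNome t + 64 * halfNome t ^ 3 ≤ realTheta2 t ^ 4 := by
  set y := Real.exp (-π * t / 4) with hy
  have hy0 : 0 < y := Real.exp_pos _
  have hx : halfNome t = y ^ 4 := by
    rw [halfNome, hy, ← Real.exp_nat_mul]
    congr 1
    push_cast
    ring
  have h1 : 2 * y + 2 * y ^ 9 ≤ realTheta2 t := by
    -- The indices n and −1 − n give equal terms, so these four are the two largest pairs.
    have h := (summable_realTheta2 ht).sum_le_tsum ({-2, -1, 0, 1} : Finset ℤ)
      (fun n _ ↦ (Real.exp_pos _).le)
    rw [Finset.sum_insert (by decide), Finset.sum_insert (by decide),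
      Finset.sum_insert (by decide), Finset.sum_singleton] at h
    have a1 : y = Real.exp (-π * (((0 : ℤ) : ℝ) + 1 / 2) ^ 2 * t) := by
      rw [hy]; congr 1; push_cast; ring
    have a2 : y = Real.exp (-π * (((-1 : ℤ) : ℝ) + 1 / 2) ^ 2 * t) := by
      rw [hy]; congr 1; push_cast; ring
    have a3 : y ^ 9 = Real.exp (-π * (((1 : ℤ) : ℝ) + 1 / 2) ^ 2 * t) := by
      rw [hy, ← Real.exp_nat_mul]; congr 1; push_cast; ring
    have a4 : y ^ 9 = Real.exp (-π * (((-2 : ℤ) : ℝ) + 1 / 2) ^ 2 * t) := by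
      rw [hy, ← Real.exp_nat_mul]; congr 1; push_cast; ring
    rw [← a1, ← a2, ← a3, ← a4] at h
    rw [realTheta2]
    linarith
  calc 16 * halfNome t + 64 * halfNome t ^ 3 ≤ (2 * y + 2 * y ^ 9) ^ 4 := by
        rw [hx]
        have : (2 * y + 2 * y ^ 9) ^ 4 =
          16 * y ^ 4 + 64 * (y ^ 4) ^ 3 + (96 * y ^ 20 + 64 * y ^ 28 + 16 * y ^ 36) := by ring
        rw [this]
        have : 0 ≤ 96 * y ^ 20 + 64 * y ^ 28 + 16 * y ^ 36 := by positivity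
        linarith
    _ ≤ realTheta2 t ^ 4 := pow_le_pow_left₀ (by positivity) h1 4

theorem le_realTheta4 {t : ℝ} (ht : 0 < t) (hx : halfNome t ≤ 1 / 3) :
    1 - 2 * halfNome t + 2 * halfNome t ^ 4 - 3 * halfNome t ^ 9 ≤ realTheta4 t := by
  have hx0 := halfNome_pos t
  -- Folding n with −n counts n = 0 twice, hence the extra 1.
  have h1 : HasSum (fun n : ℕ ↦ 2 * ((-1) ^ n * halfNome t ^ (n ^ 2))) (realTheta4 t + 1) := by
    have h := (summable_realTheta4 ht).hasSum.nat_add_neg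
    simp only [Int.cast_zero, zpow_zero] at h
    norm_num at h
    simp only [realTheta4, neg_mul]
    refine h.congr_fun fun n ↦ ?_
    have e : halfNome t ^ (n ^ 2) = Real.exp (-(π * (n : ℝ) ^ 2 * t)) := by
      rw [halfNome, ← Real.exp_nat_mul]
      congr 1
      push_cast
      ring
    have e2 : ((-1 : ℝ) ^ n)⁻¹ = (-1) ^ n := by
      rw [← inv_pow]
      norm_num
    rw [e, e2]
    ring
  have h2 := (hasSum_nat_add_iff' 3).mpr h1
  -- Since (n + 3)² ≥ 9 + n and x ≤ 1/3, the tail is at least −2x⁹ ∑ 3^(−n) = −3x⁹, whatever the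
  -- signs.
  have h3 : HasSum (fun n : ℕ ↦ -(2 * halfNome t ^ 9) * (1 / 3) ^ n)
      (-(2 * halfNome t ^ 9) * (1 - 1 / 3)⁻¹) :=
    (hasSum_geometric_of_lt_one (by norm_num) (by norm_num)).mul_left _
  have h4 := hasSum_le (fun n ↦ ?_) h3 h2
  · norm_num [Finset.sum_range_succ] at h4
    linarith
  · have h5 : halfNome t ^ ((n + 3) ^ 2) ≤ halfNome t ^ 9 * (1 / 3) ^ n := by
      calc halfNome t ^ ((n + 3) ^ 2) ≤ halfNome t ^ (9 + n) :=
            pow_le_pow_of_le_one hx0.le (by linarith) (by nlinarith)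
        _ = halfNome t ^ 9 * halfNome t ^ n := pow_add _ _ _
        _ ≤ _ := by gcongr
    have h6 : 0 < halfNome t ^ ((n + 3) ^ 2) := by positivity
    rcases neg_one_pow_eq_or ℝ (n + 3) with h | h <;> rw [h] <;> nlinarith

/-! ### Explicit estimates for the Eisenstein side -/

theorem sigma_values : σ 1 1 = 1 ∧ σ 1 2 = 3 ∧ σ 1 3 = 4 ∧ σ 3 1 = 1 ∧ σ 3 2 = 9 ∧ σ 3 3 = 28 ∧
    σ 5 1 = 1 ∧ σ 5 2 = 33 ∧ σ 5 3 = 244 := by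
  decide +kernel

/-- Successive powers of a number in `[0, c]` are comparable. -/
theorem pow_succ_le_mul_pow {x c : ℝ} (h0 : 0 ≤ x) (h1 : x ≤ c) (n : ℕ) :
    0 ≤ x ^ n ∧ x ^ (n + 1) ≤ c * x ^ n := by
  refine ⟨by positivity, ?_⟩
  rw [pow_succ, mul_comm]
  exact mul_le_mul_of_nonneg_right h1 (by positivity)

theorem sigmaSum_zero_one_le {q : ℝ} (h0 : 0 < q) (h1 : q ≤ 28 / 10000) :
    sigmaSum 0 1 q ≤ q + 3 * q ^ 2 + 51 * q ^ 3 := by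
  have h := sigmaSum_le (j := 0) (k := 1) (by norm_num) h0 h1
  simp [Finset.sum_range_succ, sigma_values] at h
  linarith

theorem le_sigmaSum_zero_three {q : ℝ} (h0 : 0 < q) (h1 : q ≤ 28 / 10000) :
    q + 9 * q ^ 2 + 28 * q ^ 3 ≤ sigmaSum 0 3 q := by
  have h := sum_range_le_sigmaSum 0 3 4 h0.le (by linarith)
  simp [Finset.sum_range_succ, sigma_values] at h
  linarith

theorem sigmaSum_zero_three_le {q : ℝ} (h0 : 0 < q) (h1 : q ≤ 28 / 10000) :
    sigmaSum 0 3 q ≤ q + 9 * q ^ 2 + 75 * q ^ 3 := by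
  have h := sigmaSum_le (j := 0) (k := 3) (by norm_num) h0 h1
  simp [Finset.sum_range_succ, sigma_values] at h
  linarith

theorem le_sigmaSum_zero_five {q : ℝ} (h0 : 0 < q) (h1 : q ≤ 28 / 10000) :
    q + 33 * q ^ 2 + 244 * q ^ 3 ≤ sigmaSum 0 5 q := by
  have h := sum_range_le_sigmaSum 0 5 4 h0.le (by linarith)
  simp [Finset.sum_range_succ, sigma_values] at h
  linarith

theorem sigmaSum_zero_five_le {q : ℝ} (h0 : 0 < q) (h1 : q ≤ 28 / 10000) :
    sigmaSum 0 5 q ≤ q + 33 * q ^ 2 + 291 * q ^ 3 := by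
  have h := sigmaSum_le (j := 0) (k := 5) (by norm_num) h0 h1
  simp [Finset.sum_range_succ, sigma_values] at h
  linarith

theorem le_sigmaSum_one_one {q : ℝ} (h0 : 0 < q) (h1 : q < 1) :
    q + 6 * q ^ 2 + 12 * q ^ 3 ≤ sigmaSum 1 1 q := by
  have h := sum_range_le_sigmaSum 1 1 4 h0.le h1
  simp [Finset.sum_range_succ, sigma_values] at h
  linarith

theorem le_sigmaSum_one_five {q : ℝ} (h0 : 0 < q) (h1 : q < 1) :
    q + 66 * q ^ 2 + 732 * q ^ 3 ≤ sigmaSum 1 5 q := by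
  have h := sum_range_le_sigmaSum 1 5 4 h0.le h1
  simp [Finset.sum_range_succ, sigma_values] at h
  linarith

theorem sigmaSum_one_five_le {q : ℝ} (h0 : 0 < q) (h1 : q ≤ 28 / 10000) :
    sigmaSum 1 5 q ≤ q + 66 * q ^ 2 + 779 * q ^ 3 := by
  have h := sigmaSum_le (j := 1) (k := 5) (by norm_num) h0 h1
  simp [Finset.sum_range_succ, sigma_values] at h
  linarith

theorem sigmaSum_mono (j : ℕ) {k l : ℕ} (hkl : k ≤ l) {q : ℝ} (h0 : 0 ≤ q) (h1 : q < 1) :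
    sigmaSum j k q ≤ sigmaSum j l q := by
  refine (summable_sigmaSum j k h0 h1).tsum_le_tsum (fun n ↦ ?_) (summable_sigmaSum j l h0 h1)
  have : (σ k n : ℝ) ≤ σ l n := by exact_mod_cast ArithmeticFunction.sigma_mono k l n hkl
  gcongr

/-- The constant terms of E₄³ and E₆² are cancelled here, so that bounds on the divisor sums yield
bounds of the right order in q. -/
theorem deltaSum_eq (q : ℝ) : deltaSum q = 5 / 12 * sigmaSum 0 3 q + 7 / 12 * sigmaSum 0 5 q +
    100 * sigmaSum 0 3 q ^ 2 - 147 * sigmaSum 0 5 q ^ 2 + 8000 * sigmaSum 0 3 q ^ 3 := by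
  rw [deltaSum]
  ring

/-- The true expansion is q − 24q² + 252q³ − …. Here and below the leading coefficients are exact
and the last one is loosened to absorb all higher powers through `pow_succ_le_mul_pow`. -/
theorem deltaSum_le {q : ℝ} (h0 : 0 < q) (h1 : q ≤ 28 / 10000) :
    deltaSum q ≤ q - 24 * q ^ 2 + 340 * q ^ 3 := by
  have u3 := sigmaSum_zero_three_le h0 h1
  have l3 := le_sigmaSum_zero_three h0 h1
  have u5 := sigmaSum_zero_five_le h0 h1
  have l5 := le_sigmaSum_zero_five h0 h1
  have p3 : 0 ≤ sigmaSum 0 3 q := le_trans (by positivity) l3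
  have a := pow_le_pow_left₀ p3 u3 2
  have b := pow_le_pow_left₀ p3 u3 3
  have c := pow_le_pow_left₀ (by positivity) l5 2
  have hp := pow_succ_le_mul_pow h0.le h1
  rw [deltaSum_eq]
  linarith [hp 3, hp 4, hp 5, hp 6, hp 7, hp 8, hp 9]

theorem le_deltaSum {q : ℝ} (h0 : 0 < q) (h1 : q ≤ 28 / 10000) :
    q - 24 * q ^ 2 + 200 * q ^ 3 ≤ deltaSum q := by
  have l3 := le_sigmaSum_zero_three h0 h1
  have u5 := sigmaSum_zero_five_le h0 h1
  have l5 := le_sigmaSum_zero_five h0 h1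
  have p5 : 0 ≤ sigmaSum 0 5 q := le_trans (by positivity) l5
  have a := pow_le_pow_left₀ (by positivity) l3 2
  have b := pow_le_pow_left₀ (by positivity) l3 3
  have c := pow_le_pow_left₀ p5 u5 2
  have hp := pow_succ_le_mul_pow h0.le h1
  rw [deltaSum_eq]
  linarith [hp 3, hp 4, hp 5, hp 6, hp 7, hp 8, hp 9]

theorem deltaSum_lower_nonneg {q : ℝ} (h0 : 0 < q) (h1 : q ≤ 28 / 10000) :
    0 ≤ q - 24 * q ^ 2 + 200 * q ^ 3 := by
  have hp := pow_succ_le_mul_pow h0.le h1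
  linarith [hp 1, hp 3]

/-- The q² terms of S_{1,5}² and Δ S_{1,1} cancel; the q³ coefficient is 24385536 · (132 + 18). -/
theorem phiNum_le {q : ℝ} (h0 : 0 < q) (h1 : q ≤ 28 / 10000) :
    phiNum q ≤ 3657830400 * q ^ 3 + 150000000000 * q ^ 4 := by
  have u := sigmaSum_one_five_le h0 h1
  have l := le_sigmaSum_one_five h0 (by linarith)
  have a := pow_le_pow_left₀ (le_trans (by positivity) l) u 2
  have b := mul_le_mul (le_deltaSum h0 h1) (le_sigmaSum_one_one h0 (by linarith))
    (by positivity) ((deltaSum_lower_nonneg h0 h1).trans (le_deltaSum h0 h1))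
  have hp := pow_succ_le_mul_pow h0.le h1
  rw [phiNum]
  linarith [hp 3, hp 4, hp 5, hp 6]

theorem deltaSum_sq_le {q : ℝ} (h0 : 0 < q) (h1 : q ≤ 28 / 10000) :
    deltaSum q ^ 2 ≤ q ^ 2 - 48 * q ^ 3 + 1300 * q ^ 4 := by
  have a := pow_le_pow_left₀ ((deltaSum_lower_nonneg h0 h1).trans (le_deltaSum h0 h1))
    (deltaSum_le h0 h1) 2
  have hp := pow_succ_le_mul_pow h0.le h1
  linarith [hp 4, hp 5, hp 6]

theorem le_deltaSum_sq {q : ℝ} (h0 : 0 < q) (h1 : q ≤ 28 / 10000) :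
    q ^ 2 - 48 * q ^ 3 + 940 * q ^ 4 ≤ deltaSum q ^ 2 := by
  have a := pow_le_pow_left₀ (deltaSum_lower_nonneg h0 h1) (le_deltaSum h0 h1) 2
  have hp := pow_succ_le_mul_pow h0.le h1
  linarith [hp 4, hp 5, hp 6]

/-- The leading terms match, as 84672 − 24192 = 60480. The next coefficient is 9434880 = 6531840 +
48 · 60480. -/
theorem le_phiNumLinear {q : ℝ} (h0 : 0 < q) (h1 : q ≤ 28 / 10000) :
    9434880 * q ^ 3 ≤ phiNumLinear q * q - 60480 * deltaSum q ^ 2 := by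
  have hd := (deltaSum_lower_nonneg h0 h1).trans (le_deltaSum h0 h1)
  have s0 : 0 ≤ sigmaSum 0 1 q := tsum_nonneg fun n ↦ by positivity
  have a := mul_le_mul (deltaSum_le h0 h1) (sigmaSum_zero_one_le h0 h1) s0
    (hd.trans (deltaSum_le h0 h1))
  have l5 := le_sigmaSum_zero_five h0 h1
  have b := mul_le_mul l5 (le_sigmaSum_one_five h0 (by linarith)) (by positivity)
    (le_trans (by positivity) l5)
  have c := le_deltaSum h0 h1
  have d := sigmaSum_one_five_le h0 h1
  have e := deltaSum_sq_le h0 h1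
  have hp := pow_succ_le_mul_pow h0.le h1
  have key : 60480 * q + 6531840 * q ^ 2 + 500000000 * q ^ 3 ≤ phiNumLinear q := by
    rw [phiNumLinear]
    linarith [hp 3, hp 4, hp 5, hp 6]
  have := mul_le_mul_of_nonneg_right key h0.le
  linarith [hp 3, hp 4]

theorem phiNumQuadratic_le {q : ℝ} (h0 : 0 < q) (h1 : q ≤ 28 / 10000) :
    phiNumQuadratic q ≤ 24 + 60480 * q + 3265920 * q ^ 2 + 460000000 * q ^ 3 := by
  have l5 := le_sigmaSum_zero_five h0 h1
  have a := pow_le_pow_left₀ (le_trans (by positivity) l5) (sigmaSum_zero_five_le h0 h1) 2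
  have b := deltaSum_le h0 h1
  have hp := pow_succ_le_mul_pow h0.le h1
  rw [phiNumQuadratic]
  linarith [hp 3, hp 4, hp 5, hp 6]

/-- S_{1,5} ≥ S_{1,1} > q ≥ Δ gives S_{1,5}² ≥ S_{1,1}² > Δ S_{1,1}. -/
theorem phiNum_pos {t : ℝ} (ht : 0 < t) : 0 < phiNum (nome t) := by
  have h0 := nome_pos t
  have h1 := nome_lt_one ht
  have a := sigmaSum_mono 1 (show 1 ≤ 5 by norm_num) h0.le h1
  have b := le_sigmaSum_one_one h0 h1
  have c := deltaSum_le_nome ht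
  have hT : nome t < sigmaSum 1 1 (nome t) := by
    nlinarith [pow_pos h0 2, pow_pos h0 3]
  rw [phiNum]
  nlinarith [mul_le_mul_of_nonneg_right c (h0.trans hT).le]

theorem thetaPoly_pos {a b : ℝ} (ha : 0 < a) (hb : 0 ≤ b) : 0 < thetaPoly a b := by
  rw [thetaPoly]
  positivity

/-! ### Lower bounds for the theta polynomial -/

theorem le_thetaPoly {t : ℝ} (ht : 0 < t) (hx : halfNome t ≤ 1 / 10) :
    7340032 * halfNome t ^ 5 ≤ thetaPoly (realTheta2 t ^ 4) (realTheta4 t ^ 4) := by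
  have hx0 := halfNome_pos t
  set x := halfNome t
  have hp := pow_succ_le_mul_pow hx0.le hx
  have ha : 16 * x ≤ realTheta2 t ^ 4 := by
    linarith [le_realTheta2_pow ht, hp 3]
  have hl : 1 - 2 * x ≤ realTheta4 t := by
    linarith [le_realTheta4 ht (by linarith), hp 4, hp 5, hp 6, hp 7, hp 8]
  have hb : 1 - 8 * x ≤ realTheta4 t ^ 4 := by
    have := pow_le_pow_left₀ (by linarith) hl 4
    linarith [hp 1, hp 2, hp 3, hp 4]
  have hb0 : 0 ≤ 1 - 8 * x := by linarith
  have h5 := pow_le_pow_left₀ (by positivity) ha 5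
  have e1 := mul_le_mul ha hb hb0 (le_trans (by positivity) ha)
  have e2 := pow_le_pow_left₀ hb0 hb 2
  have e3 := pow_le_pow_left₀ (by positivity) ha 2
  -- Inserting 16x and 1 − 8x, the linear terms cancel and 7 + 64x² remains.
  have h7 : 7 ≤ 2 * (realTheta2 t ^ 4) ^ 2 + 7 * realTheta2 t ^ 4 * realTheta4 t ^ 4 +
      7 * (realTheta4 t ^ 4) ^ 2 := by
    nlinarith [hp 2]
  rw [thetaPoly]
  calc 7340032 * x ^ 5 = (16 * x) ^ 5 * 7 := by ring
    _ ≤ _ := mul_le_mul h5 h7 (by norm_num) (by positivity)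

/-- The expansion in x = e^(−πt) is exact through x⁴, its x and x³ terms vanishing; the x⁵ term
absorbs the rest. -/
theorem le_thetaPoly_swap {t : ℝ} (ht : 0 < t) (hx : halfNome t ≤ 433 / 10000) :
    2 - 560 * halfNome t ^ 2 + 196560 * halfNome t ^ 4 - 3700000 * halfNome t ^ 5 ≤
      thetaPoly (realTheta4 t ^ 4) (realTheta2 t ^ 4) := by
  have hx0 := halfNome_pos t
  set x := halfNome t
  have hp := pow_succ_le_mul_pow hx0.le hx
  have ha := le_realTheta2_pow ht
  set a := realTheta2 t ^ 4
  have ha0 : 0 ≤ 16 * x + 64 * x ^ 3 := by positivity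
  have hl : 1 - 2 * x + 2 * x ^ 4 - x ^ 5 ≤ realTheta4 t := by
    linarith [le_realTheta4 ht (by linarith), hp 5, hp 6, hp 7, hp 8]
  have hl2 : 1 - 4 * x + 4 * x ^ 2 + 4 * x ^ 4 - 11 * x ^ 5 ≤ realTheta4 t ^ 2 := by
    have := pow_le_pow_left₀ (by linarith [hp 4]) hl 2
    linarith [hp 5, hp 6, hp 7, hp 8, hp 9, hp 10]
  have hb1 : 1 - 8 * x + 24 * x ^ 2 - 32 * x ^ 3 + 24 * x ^ 4 - 60 * x ^ 5 ≤ realTheta4 t ^ 4 := by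
    have := pow_le_pow_left₀ (by linarith [hp 2, hp 4]) hl2 2
    linarith [hp 5, hp 6, hp 7, hp 8, hp 9, hp 10]
  have hb1' : 0 ≤ 1 - 8 * x + 24 * x ^ 2 - 32 * x ^ 3 + 24 * x ^ 4 - 60 * x ^ 5 := by
    linarith [hp 2, hp 4]
  set b := realTheta4 t ^ 4
  have hb2 : 1 - 16 * x + 112 * x ^ 2 - 448 * x ^ 3 + 1136 * x ^ 4 - 2050 * x ^ 5 ≤ b ^ 2 := by
    have := pow_le_pow_left₀ hb1' hb1 2
    linarith [hp 5, hp 6, hp 7, hp 8, hp 9, hp 10]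
  have hb4 : 1 - 32 * x + 480 * x ^ 2 - 4480 * x ^ 3 + 29152 * x ^ 4 - 141000 * x ^ 5 ≤
      (b ^ 2) ^ 2 := by
    have := pow_le_pow_left₀ (by linarith [hp 2, hp 4]) hb2 2
    linarith [hp 5, hp 6, hp 7, hp 8, hp 9, hp 10]
  have hb5 : 1 - 40 * x + 760 * x ^ 2 - 9120 * x ^ 3 + 77560 * x ^ 4 - 499000 * x ^ 5 ≤ b ^ 5 := by
    have := mul_le_mul hb4 hb1 hb1' (by positivity)
    linarith [hp 5, hp 6, hp 7, hp 8, hp 9, hp 10]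
  have hin : 2 + 80 * x + 1120 * x ^ 2 + 2240 * x ^ 3 + 9440 * x ^ 4 ≤
      2 * b ^ 2 + 7 * b * a + 7 * a ^ 2 := by
    have e1 := mul_le_mul hb1 ha ha0 (hb1'.trans hb1)
    have e2 := pow_le_pow_left₀ ha0 ha 2
    linarith [hp 5, hp 6, hp 7, hp 8, hp 9, hp 10]
  have hfin := mul_le_mul hb5 hin (by positivity) (pow_nonneg (hb1'.trans hb1) 5)
  rw [thetaPoly]
  linarith [hp 5, hp 6, hp 7, hp 8, hp 9, hp 10]

/-! ### Numerical bounds for e^(−πt) -/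

theorem exp_one_pow_three_ge : (20.085 : ℝ) ≤ Real.exp 3 := by
  have h := pow_le_pow_left₀ (by norm_num) Real.exp_one_gt_d9.le 3
  rw [← Real.exp_nat_mul] at h
  norm_num at h
  linarith

theorem exp_neg_pi_le : Real.exp (-π) ≤ 433 / 10000 := by
  have h1 : (1.1515 : ℝ) ≤ Real.exp 0.1415 := by
    have := Real.quadratic_le_exp_of_nonneg (show (0 : ℝ) ≤ 0.1415 by norm_num)
    norm_num at this ⊢
    linarith
  have h2 : Real.exp 3 * Real.exp 0.1415 ≤ Real.exp π := by
    rw [← Real.exp_add]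
    exact Real.exp_le_exp.mpr (by linarith [Real.pi_gt_d4])
  have h3 : (10000 / 433 : ℝ) ≤ Real.exp π := by
    have := mul_le_mul exp_one_pow_three_ge h1 (by norm_num) (Real.exp_pos _).le
    norm_num at this ⊢
    linarith
  rw [Real.exp_neg]
  exact (inv_anti₀ (by norm_num) h3).trans (by norm_num)

/-- Follows from t ≤ 1 + π(t − 1) ≤ e^(π(t − 1)). It serves to absorb the factor t² in front of
`phiNum`. -/
theorem mul_halfNome_le {t : ℝ} (ht : 1 ≤ t) : t * halfNome t ≤ 433 / 10000 := by
  refine le_trans ?_ exp_neg_pi_le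
  have h1 : t ≤ Real.exp (π * (t - 1)) := by
    have := Real.add_one_le_exp (π * (t - 1))
    nlinarith [Real.pi_gt_three]
  calc t * halfNome t ≤ Real.exp (π * (t - 1)) * halfNome t :=
        mul_le_mul_of_nonneg_right h1 (halfNome_pos t).le
    _ = Real.exp (-π) := by
        rw [halfNome, ← Real.exp_add]
        congr 1
        ring

theorem halfNome_le_of_one_le {t : ℝ} (ht : 1 ≤ t) : halfNome t ≤ 433 / 10000 := by
  nlinarith [mul_halfNome_le ht, halfNome_pos t]

/-- As 0.0525² < 0.0028, the estimates in q are available from t = 0.94 on. -/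
theorem halfNome_le_of_le {t : ℝ} (ht : 94 / 100 ≤ t) : halfNome t ≤ 525 / 10000 := by
  have h1 : Real.exp 3 * Real.exp (-(0.05)) ≤ Real.exp (π * t) := by
    rw [← Real.exp_add]
    exact Real.exp_le_exp.mpr (by nlinarith [Real.pi_gt_d4])
  have h2 : (0.95 : ℝ) ≤ Real.exp (-(0.05)) := by
    have := Real.add_one_le_exp (-(0.05) : ℝ)
    linarith
  have h3 : (10000 / 525 : ℝ) ≤ Real.exp (π * t) := by
    have := mul_le_mul exp_one_pow_three_ge h2 (by norm_num) (Real.exp_pos _).le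
    norm_num at this ⊢
    linarith
  rw [halfNome, neg_mul, Real.exp_neg]
  exact (inv_anti₀ (by norm_num) h3).trans (by norm_num)

/-! ### The inequalities -/

/-- Up to the factor `π² Δ²`, this is `t ^ 10 (φ - (432 / π²) ψ_S)` at `i / t` minus its leading
asymptotics. -/
theorem numerator_sub_leading_nonneg {t : ℝ} (ht : 1 ≤ t) :
    0 ≤ -t ^ 2 * phiNum (nome t) * π ^ 2 +
      12 * π * t * (phiNumLinear (nome t) - 60480 * (deltaSum (nome t) ^ 2 / nome t)) +
      (432 * thetaPoly (realTheta4 t ^ 4) (realTheta2 t ^ 4) - 36 * phiNumQuadratic (nome t) +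
        2419200 * (deltaSum (nome t) ^ 2 / nome t)) := by
  have hx := halfNome_le_of_one_le ht
  have hx0 := halfNome_pos t
  have htx := mul_halfNome_le ht
  have hG := le_thetaPoly_swap (by linarith) hx
  have hq0 := nome_pos t
  have hqx := nome_eq_sq t
  have hq1 : nome t ≤ 28 / 10000 := by rw [hqx]; nlinarith
  have hF := phiNum_le hq0 hq1
  have hF1 : 9434880 * nome t ^ 2 ≤
      phiNumLinear (nome t) - 60480 * (deltaSum (nome t) ^ 2 / nome t) := by
    have h := div_le_div_of_nonneg_right (le_phiNumLinear hq0 hq1) hq0.le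
    have e1 : 9434880 * nome t ^ 3 / nome t = 9434880 * nome t ^ 2 := by field_simp
    have e2 : (phiNumLinear (nome t) * nome t - 60480 * deltaSum (nome t) ^ 2) / nome t =
        phiNumLinear (nome t) - 60480 * (deltaSum (nome t) ^ 2 / nome t) := by field_simp
    rwa [e1, e2] at h
  have hw : nome t - 48 * nome t ^ 2 + 940 * nome t ^ 3 ≤ deltaSum (nome t) ^ 2 / nome t := by
    rw [le_div_iff₀ hq0]
    linarith [le_deltaSum_sq hq0 hq1]
  have hF2 := phiNumQuadratic_le hq0 hq1
  generalize deltaSum (nome t) ^ 2 / nome t = w at *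
  generalize thetaPoly (realTheta4 t ^ 4) (realTheta2 t ^ 4) = G at *
  generalize phiNum (nome t) = F at *
  generalize phiNumLinear (nome t) = F1 at *
  generalize phiNumQuadratic (nome t) = F2 at *
  rw [hqx] at *
  generalize halfNome t = x at *
  have hp := pow_succ_le_mul_pow hx0.le hx
  -- Orders 1 and x² cancel: 432 · 2 = 36 · 24 and −432 · 560 − 36 · 60480 + 2419200 = 0, where
  -- 2419200 = 725760 · 10/3.
  have hc : -244900000 * x ^ 4 ≤ 432 * G - 36 * F2 + 2419200 * w := by
    linarith [hp 4, hp 5]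
  have hFt : t ^ 2 * F ≤ 7386000 * x ^ 4 := by
    have h1 : F ≤ 3939100000 * x ^ 6 := by linarith [hp 6, hp 7]
    have h2 : (t * x) ^ 2 ≤ (433 / 10000) ^ 2 := pow_le_pow_left₀ (by positivity) htx 2
    calc t ^ 2 * F ≤ t ^ 2 * (3939100000 * x ^ 6) := by gcongr
      _ = 3939100000 * x ^ 4 * (t * x) ^ 2 := by ring
      _ ≤ 3939100000 * x ^ 4 * (433 / 10000) ^ 2 := by gcongr
      _ ≤ 7386000 * x ^ 4 := by linarith [(hp 4).1]
  have hπ := Real.pi_gt_d4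
  have hπ' := Real.pi_lt_d4
  have hπ2 : π ^ 2 ≤ 9.87 := by nlinarith
  have h12 : 355 * 1000000 * x ^ 4 ≤ 12 * π * t * (F1 - 60480 * w) := by
    calc 355 * 1000000 * x ^ 4 ≤ 12 * 3.1415 * 1 * (9434880 * (x ^ 2) ^ 2) := by
          linarith [(hp 4).1]
      _ ≤ 12 * π * t * (F1 - 60480 * w) := by gcongr
  have hFπ : t ^ 2 * F * π ^ 2 ≤ 7386000 * x ^ 4 * 9.87 :=
    (mul_le_mul_of_nonneg_right hFt (by positivity)).trans
      (mul_le_mul_of_nonneg_left hπ2 (by positivity))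
  -- In units of 10⁶ x⁴: 355 − 244.9 − 7.386 · 9.87 > 0.
  linarith [(hp 4).1]

theorem le_pow_mul_inv {t : ℝ} (ht : 1 ≤ t) :
    725760 / π * Real.exp (2 * π * t) * (t - 10 / (3 * π)) ≤
      (-t ^ 2 * phiNum (nome t) + 12 / π * t * phiNumLinear (nome t) -
        36 / π ^ 2 * phiNumQuadratic (nome t)) / deltaSum (nome t) ^ 2 -
      432 / π ^ 2 *
        (-thetaPoly (realTheta4 t ^ 4) (realTheta2 t ^ 4) / deltaSum (nome t) ^ 2) := by
  have hd := deltaSum_ne_zero (show 0 < t by linarith)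
  have hπ := Real.pi_pos
  have hq : Real.exp (2 * π * t) = (nome t)⁻¹ := by
    rw [nome, ← Real.exp_neg]
    congr 1
    ring
  have hq0 := nome_pos t
  have h : 0 ≤ _ / (π ^ 2 * deltaSum (nome t) ^ 2) :=
    div_nonneg (numerator_sub_leading_nonneg ht) (by positivity)
  rw [hq, ← sub_nonneg]
  refine h.trans_eq ?_
  field_simp
  ring

/-- The left side is of order x⁶ and the right side of order x⁵, with x = e^(−πt) ≤ 0.0525. -/
theorem phiNum_mul_lt {t : ℝ} (ht : 94 / 100 ≤ t) :
    phiNum (nome t) * π ^ 2 < 432 * thetaPoly (realTheta2 t ^ 4) (realTheta4 t ^ 4) := by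
  have hx := halfNome_le_of_le ht
  have hx0 := halfNome_pos t
  have hG := le_thetaPoly (by linarith) (hx.trans (by norm_num))
  have hqx := nome_eq_sq t
  have hF := phiNum_le (nome_pos t) (by rw [hqx]; nlinarith)
  have hF0 := phiNum_pos (show 0 < t by linarith)
  have hp := pow_succ_le_mul_pow hx0.le hx
  have h5 : 0 < halfNome t ^ 5 := by positivity
  have hF5 : phiNum (nome t) ≤ 213800000 * halfNome t ^ 5 := by
    rw [hqx] at hF ⊢
    linarith [hp 5, hp 6, hp 7]
  have hπ2 : π ^ 2 ≤ 9.87 := by nlinarith [Real.pi_lt_d4, Real.pi_pos]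
  have := mul_le_mul hF5 hπ2 (by positivity) (by positivity)
  linarith

theorem numerator_pos_of_le {t : ℝ} (ht : 94 / 100 ≤ t) :
    0 < -phiNum (nome t) / deltaSum (nome t) ^ 2 - 432 / π ^ 2 *
      (-thetaPoly (realTheta2 t ^ 4) (realTheta4 t ^ 4) / deltaSum (nome t) ^ 2) := by
  have hd := deltaSum_ne_zero (show 0 < t by linarith)
  have hπ := Real.pi_pos
  have h := phiNum_mul_lt ht
  have e : -phiNum (nome t) / deltaSum (nome t) ^ 2 - 432 / π ^ 2 *
      (-thetaPoly (realTheta2 t ^ 4) (realTheta4 t ^ 4) / deltaSum (nome t) ^ 2) =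
      (432 * thetaPoly (realTheta2 t ^ 4) (realTheta4 t ^ 4) - phiNum (nome t) * π ^ 2) /
        (π ^ 2 * deltaSum (nome t) ^ 2) := by
    field_simp
    ring
  rw [e]
  exact div_pos (by linarith) (by positivity)

theorem numerator_neg {t : ℝ} (ht : 0 < t) :
    -phiNum (nome t) / deltaSum (nome t) ^ 2 + 432 / π ^ 2 *
      (-thetaPoly (realTheta2 t ^ 4) (realTheta4 t ^ 4) / deltaSum (nome t) ^ 2) < 0 := by
  have hd := deltaSum_ne_zero ht
  have hπ := Real.pi_pos
  have hd2 : 0 < deltaSum (nome t) ^ 2 := by positivity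
  have hA : 0 < realTheta2 t ^ 4 := pow_pos (realTheta2_pos ht) 4
  have h1 := div_pos (phiNum_pos ht) hd2
  have h2 := mul_pos (show 0 < 432 / π ^ 2 by positivity)
    (div_pos (thetaPoly_pos hA (show 0 ≤ realTheta4 t ^ 4 by positivity)) hd2)
  rw [neg_div, neg_div, mul_neg]
  linarith

theorem le_pow_mul_varphi_sub_psiS {t : ℝ} (ht : 1 ≤ t) :
    ((725760 / π * Real.exp (2 * π * t) * (t - 10 / (3 * π)) : ℝ) : ℂ) ≤
      (t : ℂ) ^ 10 * (varphi (imAxis (1 / t) (one_div_pos.mpr (zero_lt_one.trans_le ht))) -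
        432 / (π : ℂ) ^ 2 *
          psiS (imAxis (1 / t) (one_div_pos.mpr (zero_lt_one.trans_le ht)))) := by
  have ht0 : 0 < t := zero_lt_one.trans_le ht
  rw [mul_sub ((t : ℂ) ^ 10), mul_left_comm ((t : ℂ) ^ 10), pow_mul_varphi_imAxis_inv ht0, pow_mul_psiS_imAxis_inv ht0]
  exact_mod_cast le_pow_mul_inv ht

theorem varphi_sub_psiS_pos {t : ℝ} (ht : 0 < t) :
    0 < varphi (imAxis t ht) - 432 / (π : ℂ) ^ 2 * psiS (imAxis t ht) := by
  rcases le_total (94 / 100) t with h | h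
  · rw [varphi_imAxis, psiS_imAxis]
    exact_mod_cast numerator_pos_of_le h
  · have hs : 100 / 94 ≤ 1 / t := by
      rw [le_div_iff₀ ht]
      linarith
    have hπ := Real.pi_pos
    have key := le_pow_mul_varphi_sub_psiS (t := 1 / t) (by linarith)
    simp only [one_div_one_div] at key
    have hpos : 0 < 725760 / π * Real.exp (2 * π * (1 / t)) * (1 / t - 10 / (3 * π)) := by
      -- The cut-off 0.94 is chosen for this: 10/(3π) ≈ 1.0610 and 100/94 ≈ 1.0638.
      have : 10 / (3 * π) < 100 / 94 := by
        rw [div_lt_div_iff₀ (by positivity) (by norm_num)]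
        linarith [Real.pi_gt_d4]
      have h2 : 0 < 1 / t - 10 / (3 * π) := by linarith
      positivity
    rw [varphi_imAxis, psiS_imAxis] at key ⊢
    norm_cast at key ⊢
    have h10 : 0 < (1 / t) ^ 10 := by positivity
    exact (mul_pos_iff_of_pos_left h10).mp (hpos.trans_le key)

end Dim24

/-- The inequalities are in `ℂ` with its order `z ≤ w ↔ z.re ≤ w.re ∧ z.im = w.im`, so they also
assert that the quantities compared are real. -/
theorem theorem1p2 :
    (∀ (t : ℝ) (ht : 0 < t),
      Dim24.varphi (Dim24.imAxis t ht)
          + 432 / (Real.pi : ℂ) ^ 2 * Dim24.psiS (Dim24.imAxis t ht) < 0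
      ∧ Dim24.varphi (Dim24.imAxis t ht)
          - 432 / (Real.pi : ℂ) ^ 2 * Dim24.psiS (Dim24.imAxis t ht) > 0)
    ∧ (∀ (t : ℝ) (ht : 1 ≤ t),
      (t : ℂ) ^ 10
          * (Dim24.varphi (Dim24.imAxis (1 / t) (one_div_pos.mpr (zero_lt_one.trans_le ht)))
            - 432 / (Real.pi : ℂ) ^ 2
              * Dim24.psiS (Dim24.imAxis (1 / t) (one_div_pos.mpr (zero_lt_one.trans_le ht))))
        ≥ ((725760 / Real.pi * Real.exp (2 * Real.pi * t) * (t - 10 / (3 * Real.pi)) : ℝ) : ℂ)) := by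
  refine ⟨fun t ht ↦ ⟨?_, Dim24.varphi_sub_psiS_pos ht⟩,
    fun t ht ↦ Dim24.le_pow_mul_varphi_sub_psiS ht⟩
  rw [Dim24.varphi_imAxis, Dim24.psiS_imAxis]
  exact_mod_cast Dim24.numerator_neg ht
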